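/- Conventions. $\mathbb N=\{1,2,3,\dots\}$. For a left cancellative additive semigroup $S$ with zero, $C^*_r(S)$ denotes the C*-subalgebra of $B(\ell^2(S))$ generated by the isometries $V_g$, $g\in S$, given on the canonical orthonormal basis by $V_g e_h=e_{g+h}$. The Toeplitz algebra is $\mathcal T=C^*_r(\mathbb Z^+)$, where $\mathbb Z^+=\{0,1,2,\dots\}$, and $T=V_1$. For each $n\in\mathbb N$ there is a unique unital $*$-homomorphism $\mathcal T\to\mathcal T$ with $T\mapsto T^n$, and it is injective. For a sequence $M=(m_1,m_2,\dots)$ in $\mathbb N$ put $$\mathbb Q_M=\Big\{\frac{m}{m_1m_2\cdots m_s}\ \Big|\ m\in\mathbb Z,\ s\in\mathbb N\Big\}\subset\mathbb Q,\qquad \mathbb Q_M^+=\mathbb Q_M\cap[0,+\infty).$$ An inductive limit of an inductive system $(K,\{\mathfrak A_a\},\{\sigma_{ba}\})$ of unital C*-algebras with injective unital connecting $*$-homomorphisms $\sigma_{ba}:\mathfrak A_a\to\mathfrak A_b$ ($a\le b$) is a unital C*-algebra $\mathfrak A$ with injective unital $*$-homomorphisms $\sigma_a:\mathfrak A_a\to\mathfrak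 A$ such that (1) $\sigma_a=\sigma_b\circ\sigma_{ba}$ for $a\le b$ and $\bigcup_a\sigma_a(\mathfrak A_a)$ is dense in $\mathfrak A$; (2) for every unital C*-algebra $\mathfrak B$ with injective unital $*$-homomorphisms $\psi_a:\mathfrak A_a\to\mathfrak B$ satisfying the analogue of (1) there is a unique $*$-isomorphism $\theta$ of $\mathfrak A$ onto $\mathfrak B$ with $\psi_a=\theta\circ\sigma_a$ for all $a\in K$. Theorem. Let $K$ be a non-empty (upward) directed partially ordered set, and let $n_{ba}\in\mathbb N$, for $a,b\in K$ with $a\le b$, satisfy $n_{ca}=n_{cb}\,n_{ba}$ whenever $a\le b\le c$. Let $\mathcal F=(K,\{\mathcal T_a\},\{\sigma_{ba}\})$ be the inductive system with $\mathcal T_a=\mathcal T$ for all $a\in K$ and with connecting $*$-homomorphisms $\sigma_{ba}:\mathcal T\to\mathcal T$, $T\mapsto T^{n_{ba}}$. Then there is a sequence $M$ in $\mathbb N$ such that $$C^*_r(\mathbb Q_M^+)\;\simeq\;\varinjlim\mathcal F$$ as unital C*-algebras. That is, $C^*_r(\mathbb Q_M^+)$, with suitable embeddings $\mathcal T_a\to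 C^*_r(\mathbb Q_M^+)$, is an inductive limit of $\mathcal F$ (in particular an inductive limit exists), and every inductive limit of $\mathcal F$ is isomorphic to $C^*_r(\mathbb Q_M^+)$ by a unital $*$-isomorphism. -/

import Mathlib

universe u v w x

noncomputable section

namespace ToeplitzLimit

/-! ### Reduced semigroup C*-algebras -/

/-- The Hilbert space `l²(S)` of square summable complex functions on `S`. -/
abbrev Ell2 (S : Type u) : Type u := lp (fun _ : S => ℂ) 2

/-- The canonical orthonormal basis vector `e_g` of `l²(S)`: `e_g(g) = 1` and `e_g(h) = 0` for
`h ≠ g`. -/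
def basisVec {S : Type u} (g : S) : Ell2 S := by
  classical exact lp.single 2 g (1 : ℂ)

open Classical in
theorem basisVec_apply {S : Type u} (g h : S) :
    (basisVec g : Ell2 S) h = if g = h then 1 else 0 := by
  unfold basisVec
  rw [lp.single_apply, Pi.single_apply]
  split_ifs <;> simp_all

theorem inner_basisVec_left {S : Type u} (g : S) (f : Ell2 S) :
    inner ℂ (basisVec g) f = f g := by
  classical
  unfold basisVec
  rw [lp.inner_single_left]
  simp

theorem orthonormal_basisVec (S : Type u) : Orthonormal ℂ (basisVec : S → Ell2 S) := by
  classical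
  rw [orthonormal_iff_ite]
  intro g h
  rw [inner_basisVec_left, basisVec_apply]
  simp only [eq_comm]

/-- The linear isometry `l²(S) → l²(S')`, `e_s ↦ e_{f s}`, attached to an injective map `f`. -/
def basisIsometry {S : Type u} {S' : Type v} (f : S → S') (hf : Function.Injective f) :
    Ell2 S →ₗᵢ[ℂ] Ell2 S' :=
  ((orthonormal_basisVec S').comp f hf).orthogonalFamily.linearIsometry

theorem basisIsometry_basisVec {S : Type u} {S' : Type v} (f : S → S')
    (hf : Function.Injective f) (s : S) :
    basisIsometry f hf (basisVec s) = basisVec (f s) := by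
  classical
  unfold basisIsometry
  rw [basisVec.eq_1 s, OrthogonalFamily.linearIsometry_apply_single]
  simp

/-- The isometry `V_g` of `l²(S)`, `V_g e_h = e_{g+h}`, for a left cancellative (additively
written) semigroup `S` with zero. -/
def shift {S : Type u} [AddLeftCancelMonoid S] (g : S) : Ell2 S →L[ℂ] Ell2 S :=
  (basisIsometry (fun h : S => g + h) (add_right_injective g)).toContinuousLinearMap

theorem shift_basisVec {S : Type u} [AddLeftCancelMonoid S] (g h : S) :
    shift g (basisVec h) = basisVec (g + h) :=
  basisIsometry_basisVec _ (add_right_injective g) h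

/-- The reduced semigroup C*-algebra `C*_r(S)`: the C*-subalgebra of `B(l²(S))` generated by the
isometries `V_g`, `g ∈ S`. -/
def ReducedCStar (S : Type u) [AddLeftCancelMonoid S] :
    StarSubalgebra ℂ (Ell2 S →L[ℂ] Ell2 S) :=
  (StarAlgebra.adjoin ℂ (Set.range (shift : S → Ell2 S →L[ℂ] Ell2 S))).topologicalClosure

instance (S : Type u) [AddLeftCancelMonoid S] : CStarAlgebra (ReducedCStar S) :=
  StarSubalgebra.cstarAlgebra (ReducedCStar S)
    (h_closed := StarSubalgebra.isClosed_topologicalClosure _)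

theorem shift_mem {S : Type u} [AddLeftCancelMonoid S] (g : S) : shift g ∈ ReducedCStar S :=
  StarSubalgebra.le_topologicalClosure _ (StarAlgebra.subset_adjoin ℂ _ ⟨g, rfl⟩)

/-- The Toeplitz algebra `𝒯 = C*_r(ℤ⁺)`, where `ℤ⁺` is the additive semigroup of non-negative
integers. -/
abbrev Toeplitz : Type := ReducedCStar ℕ

/-- The generator `T = V_1` of the Toeplitz algebra. -/
def toeplitzT : Toeplitz := ⟨shift 1, shift_mem 1⟩

/-! ### The endomorphisms `T ↦ T ^ n` of the Toeplitz algebra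

The next lemmas only serve to prove that the definition of `toeplitzEnd` is meaningful. -/

theorem clm_ext_basisVec {S : Type u} {S' : Type v} {x y : Ell2 S →L[ℂ] Ell2 S'}
    (h : ∀ s, x (basisVec s) = y (basisVec s)) : x = y := by
  classical
  refine lp.ext_continuousLinearMap (ENNReal.ofNat_ne_top (n := nat_lit 2)) fun i => ?_
  apply ContinuousLinearMap.ext_ring
  have := h i
  unfold basisVec at this
  simpa using this

theorem ell2_ext_inner {S : Type u} {x y : Ell2 S}
    (h : ∀ s, inner ℂ (basisVec s) x = inner ℂ (basisVec s) y) : x = y := by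
  ext s
  simpa [inner_basisVec_left] using h s

theorem shift_zero' : shift (0 : ℕ) = 1 := by
  refine clm_ext_basisVec fun s => ?_
  rw [shift_basisVec, zero_add]
  rfl

theorem shift_eq_pow (k : ℕ) : shift k = shift (1 : ℕ) ^ k := by
  induction k with
  | zero => rw [pow_zero, shift_zero']
  | succ k ih =>
    rw [pow_succ, ← ih]
    refine clm_ext_basisVec fun s => ?_
    rw [shift_basisVec, mul_apply_eq_comp, shift_basisVec, shift_basisVec, add_assoc]

theorem residue_injective (n : ℕ+) (r : Fin n) :
    Function.Injective (fun q : ℕ => (n : ℕ) * q + r) := fun a b h => by simpa using h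

/-- The isometry `W_r e_q = e_{nq+r}` of `l²(ℤ⁺)`. -/
def residueIso (n : ℕ+) (r : Fin n) : Ell2 ℕ →L[ℂ] Ell2 ℕ :=
  (basisIsometry (fun q : ℕ => (n : ℕ) * q + r) (residue_injective n r)).toContinuousLinearMap

theorem residueIso_basisVec (n : ℕ+) (r : Fin n) (q : ℕ) :
    residueIso n r (basisVec q) = basisVec ((n : ℕ) * q + r) :=
  basisIsometry_basisVec _ (residue_injective n r) q

theorem inner_star_residueIso (n : ℕ+) (r : Fin n) (a : ℕ) (y : Ell2 ℕ) :
    inner ℂ (basisVec a) (star (residueIso n r) y) =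
      inner ℂ (basisVec ((n : ℕ) * a + r)) y := by
  rw [ContinuousLinearMap.star_eq_adjoint, ContinuousLinearMap.adjoint_inner_right,
    residueIso_basisVec]

theorem residue_eq_iff (n : ℕ+) (r : Fin n) (a m : ℕ) :
    (n : ℕ) * a + r = m ↔ a = m / n ∧ (r : ℕ) = m % n := by
  constructor
  · rintro rfl
    have hn : 0 < (n : ℕ) := n.pos
    constructor
    · rw [Nat.mul_add_div hn, Nat.div_eq_of_lt r.2, add_zero]
    · rw [Nat.mul_add_mod, Nat.mod_eq_of_lt r.2]
  · rintro ⟨rfl, h⟩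
    rw [h, Nat.div_add_mod]

theorem star_residueIso_basisVec (n : ℕ+) (r : Fin n) (m : ℕ) :
    star (residueIso n r) (basisVec m) = if (r : ℕ) = m % n then basisVec (m / n) else 0 := by
  refine ell2_ext_inner fun a => ?_
  rw [inner_star_residueIso, inner_basisVec_left, basisVec_apply, inner_basisVec_left]
  have h := residue_eq_iff n r a m
  by_cases h1 : (r : ℕ) = m % n
  · have h2 : (m = (n : ℕ) * a + r) ↔ (m / n = a) :=
      ⟨fun e => (h.1 e.symm).1.symm, fun e => (h.2 ⟨e.symm, h1⟩).symm⟩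
    rw [if_pos h1, basisVec_apply]
    by_cases e : m = (n : ℕ) * a + r
    · rw [if_pos e, if_pos (h2.1 e)]
    · rw [if_neg e, if_neg (fun e' => e (h2.2 e'))]
  · rw [if_neg h1, if_neg (fun h2 => h1 (h.1 h2.symm).2)]
    rfl

theorem star_residueIso_mul (n : ℕ+) (r s : Fin n) :
    star (residueIso n r) * residueIso n s = if r = s then 1 else 0 := by
  refine clm_ext_basisVec fun q => ?_
  rw [mul_apply_eq_comp, residueIso_basisVec, star_residueIso_basisVec]
  obtain ⟨h1, h2⟩ := (residue_eq_iff n s q _).1 rfl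
  rw [← h1, ← h2]
  simp only [Fin.val_inj]
  split_ifs <;> rfl

theorem sum_residueIso (n : ℕ+) : ∑ r, residueIso n r * star (residueIso n r) = 1 := by
  refine clm_ext_basisVec fun m => ?_
  have hm : m % n < n := Nat.mod_lt _ n.pos
  rw [sum_apply, Finset.sum_eq_single (⟨m % n, hm⟩ : Fin n)]
  · rw [mul_apply_eq_comp, star_residueIso_basisVec, if_pos rfl, residueIso_basisVec,
      Nat.div_add_mod]
    rfl
  · intro r _ hr
    rw [mul_apply_eq_comp, star_residueIso_basisVec, if_neg, map_zero]
    exact fun h => hr (Fin.ext h)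
  · intro h
    exact absurd (Finset.mem_univ _) h

/-- The unital `*`-homomorphism `x ↦ ∑ r, W_r x W_r^*` of `B(l²(ℤ⁺))`. -/
def ampl (n : ℕ+) : (Ell2 ℕ →L[ℂ] Ell2 ℕ) →⋆ₐ[ℂ] (Ell2 ℕ →L[ℂ] Ell2 ℕ) where
  toFun x := ∑ r, residueIso n r * x * star (residueIso n r)
  map_one' := by simp only [mul_one, sum_residueIso]
  map_mul' x y := by
    rw [Finset.sum_mul_sum]
    refine Finset.sum_congr rfl fun r _ => ?_
    rw [Finset.sum_eq_single r]
    · have h := star_residueIso_mul n r r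
      rw [if_pos rfl] at h
      calc residueIso n r * (x * y) * star (residueIso n r)
          = residueIso n r * x * 1 * y * star (residueIso n r) := by
            simp only [mul_one, mul_assoc]
        _ = _ := by rw [← h]; simp only [mul_assoc]
    · intro s _ hs
      have h := star_residueIso_mul n r s
      rw [if_neg (Ne.symm hs)] at h
      calc residueIso n r * x * star (residueIso n r) *
            (residueIso n s * y * star (residueIso n s))
          = residueIso n r * x * (star (residueIso n r) * residueIso n s) * y *
              star (residueIso n s) := by simp only [mul_assoc]
        _ = 0 := by rw [h]; simp
    · intro h
      exact absurd (Finset.mem_univ _) h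
  map_zero' := by simp
  map_add' x y := by simp only [mul_add, add_mul, Finset.sum_add_distrib]
  commutes' c := by
    simp only [Algebra.algebraMap_eq_smul_one, mul_smul_comm, smul_mul_assoc, mul_one,
      ← Finset.smul_sum, sum_residueIso]
  map_star' x := by
    simp only [star_sum, star_mul, star_star, mul_assoc]

theorem ampl_apply (n : ℕ+) (x : Ell2 ℕ →L[ℂ] Ell2 ℕ) :
    ampl n x = ∑ r, residueIso n r * x * star (residueIso n r) := rfl

theorem ampl_shift (n : ℕ+) (k : ℕ) : ampl n (shift k) = shift ((n : ℕ) * k) := by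
  have key : ∀ r, residueIso n r * shift k = shift ((n : ℕ) * k) * residueIso n r := by
    intro r
    refine clm_ext_basisVec fun q => ?_
    rw [mul_apply_eq_comp, mul_apply_eq_comp, shift_basisVec, residueIso_basisVec,
      residueIso_basisVec, shift_basisVec, mul_add, add_assoc]
  rw [ampl_apply]
  simp only [key, mul_assoc, ← Finset.mul_sum, sum_residueIso, mul_one]

theorem ampl_injective (n : ℕ+) : Function.Injective (ampl n) := by
  rw [injective_iff_map_eq_zero]
  intro x hx
  rw [ampl_apply] at hx
  let r₀ : Fin n := ⟨0, n.pos⟩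
  have h : star (residueIso n r₀) *
      (∑ r, residueIso n r * x * star (residueIso n r)) * residueIso n r₀ = x := by
    rw [Finset.mul_sum, Finset.sum_mul, Finset.sum_eq_single r₀]
    · have h := star_residueIso_mul n r₀ r₀
      rw [if_pos rfl] at h
      calc star (residueIso n r₀) * (residueIso n r₀ * x * star (residueIso n r₀)) *
            residueIso n r₀
          = (star (residueIso n r₀) * residueIso n r₀) * x *
              (star (residueIso n r₀) * residueIso n r₀) := by simp only [mul_assoc]
        _ = x := by rw [h, one_mul, mul_one]
    · intro s _ hs
      have h := star_residueIso_mul n r₀ s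
      rw [if_neg (Ne.symm hs)] at h
      calc star (residueIso n r₀) * (residueIso n s * x * star (residueIso n s)) *
            residueIso n r₀
          = (star (residueIso n r₀) * residueIso n s) * x *
              (star (residueIso n s) * residueIso n r₀) := by simp only [mul_assoc]
        _ = 0 := by rw [h]; simp
    · intro h
      exact absurd (Finset.mem_univ _) h
  rw [← h, hx]
  simp

theorem ampl_mem (n : ℕ+) (x : Toeplitz) : ampl n x ∈ ReducedCStar ℕ := by
  have hc : Continuous (ampl n) := by
    show Continuous fun x => ∑ r, residueIso n r * x * star (residueIso n r)
    fun_prop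
  have hle : ReducedCStar ℕ ≤ (ReducedCStar ℕ).comap (ampl n) := by
    refine StarSubalgebra.topologicalClosure_minimal (StarAlgebra.adjoin_le ?_) ?_
    · rintro _ ⟨k, rfl⟩
      show ampl n (shift k) ∈ ReducedCStar ℕ
      rw [ampl_shift]
      exact shift_mem _
    · exact (StarSubalgebra.isClosed_topologicalClosure _).preimage hc
  exact hle x.2

open scoped CStarAlgebra in
/-- Two unital `*`-homomorphisms on the Toeplitz algebra that agree at `T` are equal. -/
theorem toeplitz_hom_ext {B : Type v} [CStarAlgebra B] {φ ψ : Toeplitz →⋆ₐ[ℂ] B}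
    (h : φ toeplitzT = ψ toeplitzT) : φ = ψ := by
  have hφ : Continuous φ := map_continuous φ
  have hψ : Continuous ψ := map_continuous ψ
  refine StarAlgHom.ext_topologicalClosure
    (S := StarAlgebra.adjoin ℂ (Set.range (shift : ℕ → Ell2 ℕ →L[ℂ] Ell2 ℕ))) hφ hψ ?_
  refine StarAlgHom.ext_adjoin ?_
  rintro ⟨_, hx⟩ ⟨k, rfl⟩
  have hk : (⟨shift k, shift_mem k⟩ : Toeplitz) = toeplitzT ^ k := Subtype.ext (shift_eq_pow k)
  have hk' : φ ⟨shift k, shift_mem k⟩ = ψ ⟨shift k, shift_mem k⟩ := by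
    rw [hk, map_pow, map_pow, h]
  exact hk'

theorem exists_toeplitzEnd (n : ℕ+) :
    ∃ φ : Toeplitz →⋆ₐ[ℂ] Toeplitz,
      φ toeplitzT = toeplitzT ^ (n : ℕ) ∧ Function.Injective φ := by
  refine ⟨StarAlgHom.codRestrict ((ampl n).comp (ReducedCStar ℕ).subtype) (ReducedCStar ℕ)
    (ampl_mem n), ?_, ?_⟩
  · apply Subtype.ext
    show ampl n (shift 1) = shift (1 : ℕ) ^ (n : ℕ)
    rw [ampl_shift, mul_one, shift_eq_pow]
  · intro a b hab
    exact Subtype.ext (ampl_injective n (congrArg Subtype.val hab))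

theorem existsUnique_toeplitzEnd (n : ℕ+) :
    ∃! φ : Toeplitz →⋆ₐ[ℂ] Toeplitz, φ toeplitzT = toeplitzT ^ (n : ℕ) := by
  obtain ⟨φ, hφ, -⟩ := exists_toeplitzEnd n
  exact ⟨φ, hφ, fun ψ hψ => toeplitz_hom_ext (hψ.trans hφ.symm)⟩

/-- The unique unital `*`-homomorphism `𝒯 → 𝒯` with `T ↦ T ^ n`. -/
def toeplitzEnd (n : ℕ+) : Toeplitz →⋆ₐ[ℂ] Toeplitz :=
  (existsUnique_toeplitzEnd n).choose

theorem toeplitzEnd_T (n : ℕ+) : toeplitzEnd n toeplitzT = toeplitzT ^ (n : ℕ) :=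
  (existsUnique_toeplitzEnd n).choose_spec.1

theorem toeplitzEnd_injective (n : ℕ+) : Function.Injective (toeplitzEnd n) := by
  obtain ⟨φ, hφ, hinj⟩ := exists_toeplitzEnd n
  rwa [toeplitz_hom_ext ((toeplitzEnd_T n).trans hφ.symm)]

theorem toeplitzEnd_one : toeplitzEnd 1 = StarAlgHom.id ℂ Toeplitz :=
  toeplitz_hom_ext (by rw [toeplitzEnd_T, PNat.one_coe, pow_one]; rfl)

theorem toeplitzEnd_mul (m n : ℕ+) : toeplitzEnd (m * n) = (toeplitzEnd m).comp (toeplitzEnd n) :=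
  toeplitz_hom_ext (by
    rw [StarAlgHom.comp_apply, toeplitzEnd_T, toeplitzEnd_T, map_pow, toeplitzEnd_T, ← pow_mul,
      PNat.mul_coe])

/-! ### Inductive systems and inductive limits of unital C*-algebras -/

/-- An inductive system of unital C*-algebras over a partially ordered set `K`: a covariant
functor from `K` to unital C*-algebras and unital `*`-homomorphisms, all of whose connecting
morphisms `σ_{ba} : 𝔄_a → 𝔄_b`, `a ≤ b`, are injective. -/
structure InductiveSystem (K : Type u) [PartialOrder K] where
  /-- The algebra `𝔄_a`. -/
  obj : K → Type v
  [cstar : ∀ a, CStarAlgebra (obj a)]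
  /-- The connecting morphism `σ_{ba}`. -/
  map : ∀ {a b : K}, a ≤ b → (obj a →⋆ₐ[ℂ] obj b)
  map_injective : ∀ {a b : K} (h : a ≤ b), Function.Injective (map h)
  map_refl : ∀ a : K, map (le_refl a) = StarAlgHom.id ℂ (obj a)
  map_comp : ∀ {a b c : K} (h : a ≤ b) (h' : b ≤ c), map (h.trans h') = (map h').comp (map h)

attribute [instance] InductiveSystem.cstar

/-- A family of embeddings `ψ_a : 𝔄_a → B` that is compatible with the connecting morphisms and
for which the union of the images is dense in `B`. -/
structure IsDenseCocone {K : Type u} [PartialOrder K] (F : InductiveSystem.{u, v} K)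
    (B : Type w) [CStarAlgebra B] (ψ : ∀ a, F.obj a →⋆ₐ[ℂ] B) : Prop where
  injective : ∀ a, Function.Injective (ψ a)
  compatible : ∀ {a b : K} (h : a ≤ b), ψ a = (ψ b).comp (F.map h)
  dense : closure (⋃ a, Set.range (ψ a)) = Set.univ

/-- `(A, (σ_a))` is an inductive limit of the inductive system `F`: the `σ_a` are compatible
embeddings whose images have dense union, and for every other such pair `(B, (ψ_a))` there is a
unique `*`-isomorphism `θ` of `A` onto `B` with `ψ_a = θ ∘ σ_a` for all `a`. -/
structure IsInductiveLimit {K : Type u} [PartialOrder K] (F : InductiveSystem.{u, v} K)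
    (A : Type w) [CStarAlgebra A] (σ : ∀ a, F.obj a →⋆ₐ[ℂ] A) : Prop
    extends IsDenseCocone F A σ where
  existsUnique_iso : ∀ (B : Type x) [CStarAlgebra B] (ψ : ∀ a, F.obj a →⋆ₐ[ℂ] B),
    IsDenseCocone F B ψ → ∃! θ : A ≃⋆ₐ[ℂ] B, ∀ (a : K) (t : F.obj a), ψ a t = θ (σ a t)

/-- The inductive system of Toeplitz algebras over `K` defined by the natural numbers
`n b a = n_{ba}`, `a ≤ b`: all algebras are the Toeplitz algebra, and `σ_{ba}` maps `T` to
`T ^ n_{ba}`. The values of `n b a` for `a ≰ b` are not used. -/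
def toeplitzSystem {K : Type u} [PartialOrder K] (n : K → K → ℕ+)
    (hn : ∀ a b c : K, a ≤ b → b ≤ c → n c a = n c b * n b a) :
    InductiveSystem.{u, 0} K where
  obj _ := Toeplitz
  map {a b} _ := toeplitzEnd (n b a)
  map_injective _ := toeplitzEnd_injective _
  map_refl a := by
    have h := hn a a a le_rfl le_rfl
    have h1 : n a a = 1 := by simpa using h
    rw [h1, toeplitzEnd_one]
  map_comp {a b c} h h' := by
    rw [hn a b c h h', toeplitzEnd_mul]

/-! ### The groups `ℚ_M` -/

/-- The subgroup `ℚ_M = {m / (m_1 m_2 ⋯ m_s) | m ∈ ℤ, s ≥ 1}` of `ℚ` defined by a sequence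
`M = (m_1, m_2, …)` of positive integers, with `m_{i+1} = M i`. -/
def ratGroup (M : ℕ → ℕ+) : AddSubgroup ℚ where
  carrier := {q | ∃ (m : ℤ) (s : ℕ), q = m / ∏ i ∈ Finset.range (s + 1), (M i : ℚ)}
  zero_mem' := ⟨0, 0, by simp⟩
  neg_mem' := by
    rintro _ ⟨m, s, rfl⟩
    exact ⟨-m, s, by push_cast; ring⟩
  add_mem' := by
    have ne : ∀ s : ℕ, (∏ i ∈ Finset.range s, (M i : ℚ)) ≠ 0 := fun s =>
      Finset.prod_ne_zero_iff.2 fun i _ => by exact_mod_cast (M i).ne_zero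
    have raise : ∀ (m : ℤ) (s t : ℕ), s ≤ t → ∃ m' : ℤ,
        (m : ℚ) / ∏ i ∈ Finset.range (s + 1), (M i : ℚ) =
          m' / ∏ i ∈ Finset.range (t + 1), (M i : ℚ) := by
      intro m s t hst
      refine ⟨m * ∏ i ∈ Finset.Ico (s + 1) (t + 1), (M i : ℤ), ?_⟩
      rw [div_eq_div_iff (ne _) (ne _),
        ← Finset.prod_range_mul_prod_Ico (fun i => (M i : ℚ)) (Nat.succ_le_succ hst)]
      push_cast
      ring
    rintro _ _ ⟨m, s, rfl⟩ ⟨m', s', rfl⟩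
    obtain ⟨k, hk⟩ := raise m s (max s s') (le_max_left _ _)
    obtain ⟨k', hk'⟩ := raise m' s' (max s s') (le_max_right _ _)
    exact ⟨k + k', max s s', by rw [hk, hk']; push_cast; ring⟩

/-- The positive cone `Γ⁺ = Γ ∩ [0, ∞)` of a subgroup `Γ` of `ℚ`. -/
def posCone (Γ : AddSubgroup ℚ) : AddSubmonoid ℚ where
  carrier := {q | q ∈ Γ ∧ 0 ≤ q}
  zero_mem' := ⟨Γ.zero_mem, le_rfl⟩
  add_mem' ha hb := ⟨Γ.add_mem ha.1 hb.1, add_nonneg ha.2 hb.2⟩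

instance (Γ : AddSubgroup ℚ) : AddLeftCancelMonoid (posCone Γ) :=
  { (inferInstance : AddMonoid (posCone Γ)) with
    add_left_cancel := fun _ _ _ h => Subtype.ext (add_left_cancel (congrArg Subtype.val h)) }

end ToeplitzLimit

end

open ToeplitzLimit

/-!
Embeddings between C*-algebras are isometric. In a directed system the distance between
`σ_a s` and `σ_b t` in a dense cocone can therefore be computed in a single algebra `𝔄_c` above
`a` and `b`, so it is the same for every dense cocone. Consequently two dense cocones are always
isomorphic, in a unique compatible way (`IsDenseCocone.existsUnique_iso`), and it suffices to find
`M` and a dense cocone on `C*_r(ℚ_M⁺)`.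

Fix `a₀` in `K` and put `g_a = n_{ca} / n_{c a₀}` for any `c ≥ a, a₀`. Then `g_a = n_{ba} g_b` for
`a ≤ b`, and the integer multiples of the `g_a` form the group `⋃ n_{c a₀}⁻¹ ℤ`, `c ≥ a₀`. Only countably
many numbers `n_{c a₀}` occur, hence an increasing sequence in `K` exhausts this group, and the
successive quotients along it form `M` (`exists_ratGroup_generators`).

For `g > 0` in `ℚ_M⁺`, division with remainder by `g` splits `ℚ_M⁺` into the orbits
`r, r + g, r + 2g, …` with `0 ≤ r < g`. So `l²(ℚ_M⁺)` is a direct sum of copies of `l²(ℤ⁺)` on which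
`V_g` acts as a direct sum of copies of `T`, and the diagonal representation of `B(l²(ℤ⁺))`
restricts to an embedding `𝒯 → C*_r(ℚ_M⁺)` with `T ↦ V_g` (`exists_posCone_embedding`). With
`g = g_a` these embeddings are compatible since `V_{g_a} = V_{g_b} ^ n_{ba}`, and their images
contain all `V_s` because every `s` in `ℚ_M⁺` is a multiple of some `g_a`
(`isDenseCocone_of_generators`).
-/

noncomputable section

namespace ToeplitzLimit

open scoped CStarAlgebra

/-! ### Uniqueness of dense cocones over directed systems -/

section DenseCocones

variable {K : Type u} [PartialOrder K] {F : InductiveSystem.{u, v} K}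
  {A : Type w} [CStarAlgebra A] {σ : ∀ a, F.obj a →⋆ₐ[ℂ] A}
  {B : Type x} [CStarAlgebra B] {ψ : ∀ a, F.obj a →⋆ₐ[ℂ] B}

theorem IsDenseCocone.apply_map (h : IsDenseCocone F A σ) {a b : K} (hab : a ≤ b) (t : F.obj a) :
    σ b (F.map hab t) = σ a t := by
  rw [h.compatible hab, StarAlgHom.comp_apply]

theorem IsDenseCocone.isometry (h : IsDenseCocone F A σ) (a : K) : Isometry (σ a) :=
  NonUnitalStarAlgHom.isometry (σ a) (h.injective a)

/-- Any two dense cocones put the same distance between elements coming from the algebras of a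
directed system: it can be computed in an algebra further up the system. -/
theorem IsDenseCocone.dist_eq [IsDirectedOrder K] (h : IsDenseCocone F A σ)
    (h' : IsDenseCocone F B ψ) {a b : K} (s : F.obj a) (t : F.obj b) :
    dist (ψ a s) (ψ b t) = dist (σ a s) (σ b t) := by
  obtain ⟨c, hac, hbc⟩ := exists_ge_ge a b
  rw [← h.apply_map hac, ← h.apply_map hbc, ← h'.apply_map hac, ← h'.apply_map hbc,
    (h.isometry c).dist_eq, (h'.isometry c).dist_eq]

theorem IsDenseCocone.dense_iUnion (h : IsDenseCocone F A σ) : Dense (⋃ a, Set.range (σ a)) :=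
  dense_iff_closure_eq.2 h.dense

/-- A closed property of pairs that holds on every stage of a directed system holds on a dense
cocone. -/
theorem IsDenseCocone.induction₂ [IsDirectedOrder K] (h : IsDenseCocone F A σ)
    {p : A → A → Prop} (hp : IsClosed {q : A × A | p q.1 q.2})
    (hσ : ∀ a s t, p (σ a s) (σ a t)) (y z : A) : p y z := by
  refine isClosed_property2 (e := fun q : ⋃ a, Set.range (σ a) => (q : A))
    h.dense_iUnion.denseRange_val hp ?_ y z
  rintro ⟨y, hy⟩ ⟨z, hz⟩
  obtain ⟨a, s, rfl⟩ := Set.mem_iUnion.1 hy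
  obtain ⟨b, t, rfl⟩ := Set.mem_iUnion.1 hz
  obtain ⟨c, hac, hbc⟩ := exists_ge_ge a b
  have := hσ c (F.map hac s) (F.map hbc t)
  rwa [h.apply_map, h.apply_map] at this

/-- Isometric comparison of two dense cocones, as a bare map. -/
theorem IsDenseCocone.exists_isometry [IsDirectedOrder K] (h : IsDenseCocone F A σ)
    (h' : IsDenseCocone F B ψ) :
    ∃ θ : A → B, Isometry θ ∧ ∀ a t, θ (σ a t) = ψ a t := by
  -- On the dense union of the images, choose a preimage and apply the corresponding `ψ`.
  let D : Set A := ⋃ a, Set.range (σ a)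
  have hD : ∀ y : D, ∃ q : Σ a, F.obj a, σ q.1 q.2 = y := by
    rintro ⟨y, hy⟩
    obtain ⟨a, s, rfl⟩ := Set.mem_iUnion.1 hy
    exact ⟨⟨a, s⟩, rfl⟩
  choose q hq using hD
  let f : D → B := fun y => ψ (q y).1 (q y).2
  have hf : Isometry f := Isometry.of_dist_eq fun y z => by
    rw [h.dist_eq h', hq, hq]; rfl
  have hdense : Dense D := h.dense_iUnion
  have hext : ∀ y : D, hdense.extend f y = f y := hdense.extend_of_ind hf.uniformContinuous
  have hcont : Continuous (hdense.extend f) :=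
    (hdense.uniformContinuous_extend hf.uniformContinuous).continuous
  refine ⟨hdense.extend f, Isometry.of_dist_eq fun y z => ?_, fun a t => ?_⟩
  · refine isClosed_property2 (e := fun y : D => (y : A)) hdense.denseRange_val
      (p := fun y z => dist (hdense.extend f y) (hdense.extend f z) = dist y z)
      (isClosed_eq (by fun_prop) (by fun_prop)) (fun y z => ?_) y z
    rw [hext, hext, hf.dist_eq]; rfl
  · have hmem : σ a t ∈ D := Set.mem_iUnion.2 ⟨a, t, rfl⟩
    rw [hext ⟨σ a t, hmem⟩, ← dist_eq_zero]
    rw [h.dist_eq h', hq, dist_self]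

/-- Any two dense cocones over a directed system are isomorphic, by a unique isomorphism
compatible with the embeddings. -/
theorem IsDenseCocone.existsUnique_iso [IsDirectedOrder K] [Nonempty K]
    (h : IsDenseCocone F A σ) (h' : IsDenseCocone F B ψ) :
    ∃! θ : A ≃⋆ₐ[ℂ] B, ∀ (a : K) (t : F.obj a), ψ a t = θ (σ a t) := by
  obtain ⟨θ, hθ, hσ⟩ := h.exists_isometry h'
  have hc : Continuous θ := hθ.continuous
  obtain ⟨a₀⟩ := ‹Nonempty K›
  let Θ : A →⋆ₐ[ℂ] B :=
    { toFun := θ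
      map_one' := by rw [← map_one (σ a₀), hσ, map_one]
      map_mul' := h.induction₂ (isClosed_eq (by fun_prop) (by fun_prop)) fun a s t => by
        rw [← map_mul, hσ, hσ, hσ, map_mul]
      map_zero' := by rw [← map_zero (σ a₀), hσ, map_zero]
      map_add' := h.induction₂ (isClosed_eq (by fun_prop) (by fun_prop)) fun a s t => by
        rw [← map_add, hσ, hσ, hσ, map_add]
      commutes' := fun c => by
        rw [← AlgHomClass.commutes (σ a₀), hσ, AlgHomClass.commutes]
      map_star' := fun y => by
        refine h.induction₂ (p := fun y _ => θ (star y) = star (θ y))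
          (isClosed_eq (by fun_prop) (by fun_prop)) (fun a s t => ?_) y y
        rw [← map_star, hσ, hσ, map_star] }
  have hsurj : Function.Surjective Θ := by
    have hcl : IsClosed (Set.range θ) := hθ.isClosedEmbedding.isClosed_range
    have hsub : (⋃ a, Set.range (ψ a)) ⊆ Set.range θ := by
      refine Set.iUnion_subset fun a => ?_
      rintro _ ⟨t, rfl⟩
      exact ⟨σ a t, hσ a t⟩
    intro z
    exact closure_minimal hsub hcl (h'.dense.symm ▸ Set.mem_univ z)
  refine ⟨StarAlgEquiv.ofBijective Θ ⟨hθ.injective, hsurj⟩, fun a t => (hσ a t).symm, ?_⟩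
  intro η hη
  ext y
  have hηc : Continuous η := (StarAlgEquiv.isometry η).continuous
  refine h.induction₂ (p := fun y _ => η y = θ y)
    (isClosed_eq (by fun_prop) (by fun_prop)) (fun a s t => ?_) y y
  rw [← hη, hσ]

end DenseCocones

/-! ### Diagonal operators on Hilbert direct sums -/

section Diagonal

variable {R : Type u} {H : Type v} [NormedAddCommGroup H] [InnerProductSpace ℂ H]

theorem norm_apply_le_norm_smul (x : H →L[ℂ] H) (f : lp (fun _ : R => H) 2) (r : R) :
    ‖x (f r)‖ ≤ ‖((‖x‖ : ℂ) • f) r‖ := by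
  have h : ((‖x‖ : ℂ) • f) r = (‖x‖ : ℂ) • f r := rfl
  rw [h, norm_smul, Complex.norm_real, norm_norm]
  exact x.le_opNorm _

theorem memℓp_comp (x : H →L[ℂ] H) (f : lp (fun _ : R => H) 2) :
    Memℓp (fun r => x (f r)) 2 :=
  (lp.memℓp ((‖x‖ : ℂ) • f)).mono' (norm_apply_le_norm_smul x f)

/-- The operator `(f_r)_r ↦ (x f_r)_r` on the Hilbert direct sum of copies of `H` indexed by `R`. -/
def diagCLM (R : Type u) (x : H →L[ℂ] H) :
    lp (fun _ : R => H) 2 →L[ℂ] lp (fun _ : R => H) 2 :=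
  LinearMap.mkContinuous
    { toFun := fun f => (⟨fun r => x (f r), memℓp_comp x f⟩ : lp (fun _ : R => H) 2)
      map_add' := fun f g => Subtype.ext (funext fun r => map_add x (f r) (g r))
      map_smul' := fun c f => Subtype.ext (funext fun r => map_smul x c (f r)) }
    ‖x‖ fun f => by
      refine (lp.norm_mono (by simp) (norm_apply_le_norm_smul x f)).trans_eq ?_
      rw [norm_smul, Complex.norm_real, norm_norm]

theorem diagCLM_apply (x : H →L[ℂ] H) (f : lp (fun _ : R => H) 2) (r : R) :
    diagCLM R x f r = x (f r) := rfl

theorem diagCLM_single [DecidableEq R] (x : H →L[ℂ] H) (r : R) (v : H) :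
    diagCLM R x (lp.single 2 r v) = lp.single 2 r (x v) := by
  ext s : 2
  rw [diagCLM_apply, lp.single_apply, lp.single_apply]
  by_cases h : s = r
  · subst h; simp
  · simp [h]

/-- The diagonal representation of the bounded operators of a Hilbert space on a Hilbert direct
sum of copies of that space. -/
def diagHom (R : Type u) (H : Type v) [NormedAddCommGroup H] [InnerProductSpace ℂ H]
    [CompleteSpace H] :
    (H →L[ℂ] H) →⋆ₐ[ℂ] (lp (fun _ : R => H) 2 →L[ℂ] lp (fun _ : R => H) 2) where
  toFun := diagCLM R
  map_one' := rfl
  map_mul' _ _ := rfl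
  map_zero' := rfl
  map_add' _ _ := rfl
  commutes' _ := rfl
  map_star' x := by
    rw [ContinuousLinearMap.star_eq_adjoint, ContinuousLinearMap.star_eq_adjoint,
      ContinuousLinearMap.eq_adjoint_iff]
    intro f g
    simp only [lp.inner_eq_tsum, diagCLM_apply, ContinuousLinearMap.adjoint_inner_left]

theorem diagHom_injective (R : Type u) [Nonempty R] [CompleteSpace H] :
    Function.Injective (diagHom R H) := by
  classical
  obtain ⟨r⟩ := ‹Nonempty R›
  intro x y hxy
  ext v
  have h : diagCLM R x (lp.single 2 r v) = diagCLM R y (lp.single 2 r v) :=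
    congrArg (fun T => T (lp.single 2 r v)) hxy
  rw [diagCLM_single, diagCLM_single] at h
  simpa using congrArg (fun f => f r) h

end Diagonal

/-! ### Embeddings of the Toeplitz algebra given by orbit decompositions -/

section Embedding

variable {S : Type u} {R : Type v} {p : ℕ × R → S}

/-- The isometry `l²(ℕ) → l²(S)`, `e_q ↦ e_{p (q, r)}`, onto the slice with index `r`. -/
def sliceIsometry (hp : Function.Injective p) (r : R) : Ell2 ℕ →ₗᵢ[ℂ] Ell2 S :=
  basisIsometry (fun q => p (q, r)) fun _ _ h => (Prod.ext_iff.1 (hp h)).1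

theorem sliceIsometry_basisVec (hp : Function.Injective p) (r : R) (q : ℕ) :
    sliceIsometry hp r (basisVec q) = basisVec (p (q, r)) :=
  basisIsometry_basisVec _ _ q

/-- Restricting a bijection `ℕ × R → S` to the slices `ℕ × {r}` decomposes `l²(S)` into copies of
`l²(ℕ)`. -/
theorem isHilbertSum_slices (hp : Function.Bijective p) :
    IsHilbertSum ℂ (fun _ : R => Ell2 ℕ) (sliceIsometry hp.injective) := by
  refine IsHilbertSum.mk ?_ ?_
  · intro r s hrs v w
    set V := (sliceIsometry hp.injective r).toContinuousLinearMap
    set W := (sliceIsometry hp.injective s).toContinuousLinearMap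
    -- Orthogonality of the ranges need only be checked on basis vectors.
    have h0 : ContinuousLinearMap.adjoint V ∘L W = 0 := by
      refine clm_ext_basisVec fun k => ell2_ext_inner fun l => ?_
      rw [ContinuousLinearMap.comp_apply, ContinuousLinearMap.adjoint_inner_right]
      change inner ℂ (sliceIsometry hp.injective r (basisVec l))
        (sliceIsometry hp.injective s (basisVec k)) = inner ℂ (basisVec l) 0
      rw [sliceIsometry_basisVec, sliceIsometry_basisVec, inner_basisVec_left, basisVec_apply,
        if_neg, inner_zero_right]
      exact fun h => hrs (Prod.ext_iff.1 (hp.injective h)).2.symm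
    have h1 := ContinuousLinearMap.adjoint_inner_right V v (W w)
    rw [← ContinuousLinearMap.comp_apply, h0] at h1
    exact h1.symm.trans (inner_zero_right v)
  · rw [top_le_iff, Submodule.topologicalClosure_eq_top_iff, Submodule.eq_bot_iff]
    intro y hy
    refine ell2_ext_inner fun s => ?_
    obtain ⟨⟨q, r⟩, rfl⟩ := hp.surjective s
    rw [inner_zero_right]
    refine (Submodule.mem_orthogonal _ _).1 hy _ (Submodule.mem_iSup_of_mem r ?_)
    exact ⟨basisVec q, sliceIsometry_basisVec _ _ q⟩

variable [AddLeftCancelMonoid S]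

/-- If `S` is a disjoint union of orbits `r, g + r, g + g + r, …`, indexed by `R`, then `V_g` is a
direct sum of copies of the unilateral shift, so that `T ↦ V_g` is an embedding of the Toeplitz
algebra. -/
theorem exists_embedding_of_bijective [Nonempty R] (hp : Function.Bijective p) (g : S)
    (hg : ∀ q r, p (q + 1, r) = g + p (q, r)) :
    ∃ φ : Toeplitz →⋆ₐ[ℂ] ReducedCStar S,
      φ toeplitzT = ⟨shift g, shift_mem g⟩ ∧ Function.Injective φ := by
  classical
  let U := (isHilbertSum_slices hp).linearIsometryEquiv
  have hU : ∀ q r, U.symm (lp.single 2 r (basisVec q)) = basisVec (p (q, r)) := fun q r => by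
    rw [IsHilbertSum.linearIsometryEquiv_symm_apply_single, sliceIsometry_basisVec]
  let Φ : (Ell2 ℕ →L[ℂ] Ell2 ℕ) →⋆ₐ[ℂ] (Ell2 S →L[ℂ] Ell2 S) :=
    (U.symm.conjStarAlgEquiv : _ →⋆ₐ[ℂ] _).comp (diagHom R (Ell2 ℕ))
  have hΦ : Φ (shift 1) = shift g := by
    refine clm_ext_basisVec fun s => ?_
    obtain ⟨⟨q, r⟩, rfl⟩ := hp.surjective s
    change U.symm (diagCLM R (shift 1) (U.symm.symm (basisVec (p (q, r))))) = _
    rw [← hU, LinearIsometryEquiv.symm_apply_apply, diagCLM_single, shift_basisVec, hU, hU,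
      shift_basisVec, ← hg, add_comm]
  have hinj : Function.Injective Φ :=
    U.symm.conjStarAlgEquiv.injective.comp (diagHom_injective R)
  have hmem : ReducedCStar ℕ ≤ (ReducedCStar S).comap Φ := by
    refine StarSubalgebra.topologicalClosure_minimal (StarAlgebra.adjoin_le ?_) ?_
    · rintro _ ⟨k, rfl⟩
      change Φ (shift k) ∈ ReducedCStar S
      rw [shift_eq_pow, map_pow, hΦ]
      exact pow_mem (shift_mem g) k
    · exact (StarSubalgebra.isClosed_topologicalClosure _).preimage (map_continuous Φ)
  refine ⟨StarAlgHom.codRestrict (Φ.comp (ReducedCStar ℕ).subtype) (ReducedCStar S)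
    fun x => hmem x.2, Subtype.ext hΦ, fun a b hab => ?_⟩
  exact Subtype.ext (hinj (congrArg Subtype.val hab))

end Embedding

/-! ### Embeddings for positive cones of subgroups of `ℚ` -/

section PosCone

variable {Γ : AddSubgroup ℚ}

/-- Division with remainder by `g`: every element of `Γ⁺` is uniquely `q g + r` with `q ∈ ℕ` and
`r ∈ Γ⁺`, `r < g`. -/
theorem bijective_mul_add (g : posCone Γ) (hg : 0 < (g : ℚ)) :
    Function.Bijective
      (fun z : ℕ × {r : posCone Γ // (r : ℚ) < g} => z.1 • g + (z.2 : posCone Γ)) := by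
  have hval : ∀ z : ℕ × {r : posCone Γ // (r : ℚ) < g},
      ((z.1 • g + (z.2 : posCone Γ) : posCone Γ) : ℚ) = z.1 * g + (z.2 : posCone Γ) := by
    intro z
    simp [nsmul_eq_mul]
  constructor
  · intro z z' h
    have h' := (hval z).symm.trans ((congrArg Subtype.val h).trans (hval z'))
    -- The quotient `q` is recovered as the integer part of `(q g + r) / g`.
    have hfl : ∀ z : ℕ × {r : posCone Γ // (r : ℚ) < g},
        ⌊(z.1 * g + (z.2 : posCone Γ) : ℚ) / g⌋₊ = z.1 := by
      intro z
      rw [Nat.floor_eq_iff (by have := z.2.1.2.2; positivity), le_div_iff₀ hg, div_lt_iff₀ hg]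
      have h1 := z.2.1.2.2
      have h2 := z.2.2
      constructor <;> linarith
    have h1 : z.1 = z'.1 := by rw [← hfl z, h', hfl]
    refine Prod.ext h1 (Subtype.ext (Subtype.ext ?_))
    rw [h1] at h'
    linarith
  · intro s
    have h0 : 0 ≤ (s : ℚ) / g := div_nonneg s.2.2 hg.le
    have h1 := (le_div_iff₀ hg).1 (Nat.floor_le h0)
    have h2 := (div_lt_iff₀ hg).1 (Nat.lt_floor_add_one ((s : ℚ) / g))
    refine ⟨(⌊(s : ℚ) / g⌋₊, ⟨⟨s - ⌊(s : ℚ) / g⌋₊ * g, ?_, by linarith⟩, ?_⟩), ?_⟩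
    · refine Γ.sub_mem s.2.1 ?_
      rw [← nsmul_eq_mul]
      exact Γ.nsmul_mem g.2.1 _
    · change (s - ⌊(s : ℚ) / g⌋₊ * g : ℚ) < g
      linarith
    · refine Subtype.ext ((hval _).trans ?_)
      change (⌊(s : ℚ) / g⌋₊ * g + (s - ⌊(s : ℚ) / g⌋₊ * g) : ℚ) = s
      ring

/-- For `g > 0` in `Γ⁺` the isometry `V_g` generates a copy of the Toeplitz algebra. -/
theorem exists_posCone_embedding (g : posCone Γ) (hg : 0 < (g : ℚ)) :
    ∃ φ : Toeplitz →⋆ₐ[ℂ] ReducedCStar (posCone Γ),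
      φ toeplitzT = ⟨shift g, shift_mem g⟩ ∧ Function.Injective φ := by
  have : Nonempty {r : posCone Γ // (r : ℚ) < g} := ⟨⟨0, hg⟩⟩
  refine exists_embedding_of_bijective (bijective_mul_add g hg) g fun q r => ?_
  rw [succ_nsmul]
  refine Subtype.ext ?_
  change (((q • g : posCone Γ) : ℚ) + g + (r : posCone Γ) : ℚ) =
    g + ((q • g : posCone Γ) + (r : posCone Γ))
  ring

end PosCone

/-! ### The group attached to the numbers `n_{ba}` -/

section Scale

variable {K : Type u} [PartialOrder K] [IsDirectedOrder K] {n : K → K → ℕ+}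

/-- Since there are only countably many natural numbers, an increasing sequence in `K` already
realizes all divisors occurring among the numbers `n_{c a₀}`. -/
theorem exists_divisor_cofinal_seq
    (hn : ∀ a b c : K, a ≤ b → b ≤ c → n c a = n c b * n b a) (a₀ : K) :
    ∃ b : ℕ → K, a₀ ≤ b 0 ∧ Monotone b ∧ ∀ c, a₀ ≤ c → ∃ s, n c a₀ ∣ n (b s) a₀ := by
  classical
  -- A representative `c ≥ a₀` for each value `m` of `c ↦ n c a₀`.
  have hrep : ∀ m : ℕ+, ∃ c, a₀ ≤ c ∧ ((∃ c', a₀ ≤ c' ∧ n c' a₀ = m) → n c a₀ = m) := by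
    intro m
    by_cases h : ∃ c', a₀ ≤ c' ∧ n c' a₀ = m
    · obtain ⟨c, hc, hm⟩ := h
      exact ⟨c, hc, fun _ => hm⟩
    · exact ⟨a₀, le_rfl, fun h' => absurd h' h⟩
  choose rep hrep_ge hrep_eq using hrep
  choose ub hub₁ hub₂ using fun y z : K => exists_ge_ge y z
  let b : ℕ → K := fun i =>
    Nat.rec (rep (Nat.succPNat 0)) (fun i y => ub y (rep (Nat.succPNat (i + 1)))) i
  have hmono : Monotone b := monotone_nat_of_le_succ fun i => hub₁ _ _
  have hrep_le : ∀ i, rep (Nat.succPNat i) ≤ b i := by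
    intro i
    cases i with
    | zero => exact le_rfl
    | succ i => exact hub₂ _ _
  refine ⟨b, hrep_ge _, hmono, fun c hc => ⟨(n c a₀).natPred, ?_⟩⟩
  have h := hrep_le (n c a₀).natPred
  rw [PNat.succPNat_natPred] at h
  rw [hn a₀ _ _ (hrep_ge _) h, hrep_eq _ ⟨c, hc, rfl⟩]
  exact dvd_mul_left _ _

/-- The union of the groups `n_{c a₀}⁻¹ ℤ`, `c ≥ a₀`, is of the form `ℚ_M`. -/
theorem exists_ratGroup_eq
    (hn : ∀ a b c : K, a ≤ b → b ≤ c → n c a = n c b * n b a) (a₀ : K) :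
    ∃ M : ℕ → ℕ+, ∀ q : ℚ,
      q ∈ ratGroup M ↔ ∃ c, a₀ ≤ c ∧ ∃ m : ℤ, q = m / (n c a₀ : ℚ) := by
  obtain ⟨b, hb₀, hb, hcof⟩ := exists_divisor_cofinal_seq hn a₀
  have hle : ∀ s, a₀ ≤ b s := fun s => hb₀.trans (hb (Nat.zero_le s))
  let M : ℕ → ℕ+ := fun
    | 0 => n (b 0) a₀
    | i + 1 => n (b (i + 1)) (b i)
  -- The products telescope.
  have hprod : ∀ s, ∏ i ∈ Finset.range (s + 1), ((M i : ℕ) : ℚ) = (n (b s) a₀ : ℕ) := by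
    intro s
    induction s with
    | zero => simp [M]
    | succ s ih =>
      rw [Finset.prod_range_succ, ih, hn _ _ _ (hle s) (hb s.le_succ), PNat.mul_coe, Nat.cast_mul,
        mul_comm]
  refine ⟨M, fun q => ⟨?_, ?_⟩⟩
  · rintro ⟨m, s, rfl⟩
    exact ⟨b s, hle s, m, by rw [hprod]⟩
  · rintro ⟨c, hc, m, rfl⟩
    obtain ⟨s, k, hk⟩ := hcof c hc
    refine ⟨m * k, s, ?_⟩
    have h1 : ((n c a₀ : ℕ) : ℚ) ≠ 0 := by exact_mod_cast (n c a₀).ne_zero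
    have h2 : ((k : ℕ) : ℚ) ≠ 0 := by exact_mod_cast k.ne_zero
    rw [hprod, hk]
    push_cast
    field_simp

/-- The numbers `g_a = n_{ca} / n_{c a₀}` do not depend on the common upper bound `c` of `a` and
`a₀`. They are the images of the generators at `a` in `ℚ` when the generator at `a₀` is sent to
`1`. -/
theorem exists_scale (hn : ∀ a b c : K, a ≤ b → b ≤ c → n c a = n c b * n b a) (a₀ : K) :
    ∃ g : K → ℚ, ∀ a c, a ≤ c → a₀ ≤ c → g a = (n c a : ℚ) / n c a₀ := by
  choose ub hub₁ hub₂ using fun y z : K => exists_ge_ge y z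
  have hraise : ∀ a c d, a ≤ c → a₀ ≤ c → c ≤ d →
      (n d a : ℚ) / n d a₀ = (n c a : ℚ) / n c a₀ := by
    intro a c d hac h₀c hcd
    have h : ((n d c : ℕ) : ℚ) ≠ 0 := by exact_mod_cast (n d c).ne_zero
    rw [hn a c d hac hcd, hn a₀ c d h₀c hcd]
    push_cast
    exact mul_div_mul_left _ _ h
  refine ⟨fun a => (n (ub a a₀) a : ℚ) / n (ub a a₀) a₀, fun a c hac h₀c => ?_⟩
  rw [← hraise a c (ub c (ub a a₀)) hac h₀c (hub₁ _ _),
    hraise a (ub a a₀) _ (hub₁ _ _) (hub₂ _ _) (hub₂ _ _)]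

/-- The direct limit of the groups `ℤ` with connecting maps multiplication by `n_{ba}` is a group
`ℚ_M`; the element `g_a` is the image of the generator at `a`. -/
theorem exists_ratGroup_generators [Nonempty K]
    (hn : ∀ a b c : K, a ≤ b → b ≤ c → n c a = n c b * n b a) :
    ∃ (M : ℕ → ℕ+) (g : K → posCone (ratGroup M)),
      (∀ a, 0 < (g a : ℚ)) ∧ (∀ a b, a ≤ b → g a = (n b a : ℕ) • g b) ∧
      ∀ s : posCone (ratGroup M), ∃ (c : K) (k : ℕ), s = k • g c := by
  obtain ⟨a₀⟩ := ‹Nonempty K›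
  obtain ⟨M, hM⟩ := exists_ratGroup_eq hn a₀
  obtain ⟨g, hg⟩ := exists_scale hn a₀
  have hne : ∀ a b, (0 : ℚ) < ((n b a : ℕ) : ℚ) := fun a b => by exact_mod_cast (n b a).pos
  have hpos : ∀ a, 0 < g a := by
    intro a
    obtain ⟨c, hac, h₀c⟩ := exists_ge_ge a a₀
    rw [hg a c hac h₀c]
    exact div_pos (hne _ _) (hne _ _)
  have hmem : ∀ a, g a ∈ ratGroup M := by
    intro a
    obtain ⟨c, hac, h₀c⟩ := exists_ge_ge a a₀
    exact (hM _).2 ⟨c, h₀c, (n c a : ℕ), by rw [hg a c hac h₀c]; simp⟩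
  have hcoe : ∀ (k : ℕ) (s : posCone (ratGroup M)), ((k • s : posCone (ratGroup M)) : ℚ) = k * s :=
    fun k s => by simp [nsmul_eq_mul]
  refine ⟨M, fun a => ⟨g a, hmem a, (hpos a).le⟩, hpos, fun a b hab => ?_, fun s => ?_⟩
  · obtain ⟨c, hbc, h₀c⟩ := exists_ge_ge b a₀
    refine Subtype.ext (Eq.trans ?_ (hcoe _ _).symm)
    change g a = (n b a : ℕ) * g b
    rw [hg a c (hab.trans hbc) h₀c, hg b c hbc h₀c, hn a b c hab hbc, PNat.mul_coe, Nat.cast_mul]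
    ring
  · obtain ⟨c, h₀c, m, hm⟩ := (hM _).1 s.2.1
    have hgc : g c = 1 / n c a₀ := by
      have h := hn c c c le_rfl le_rfl
      have h1 : n c c = 1 := by simpa using h
      rw [hg c c le_rfl h₀c, h1, PNat.one_coe, Nat.cast_one]
    have hm0 : 0 ≤ m := by
      have h : 0 ≤ (s : ℚ) := s.2.2
      rw [hm, le_div_iff₀ (hne _ _), zero_mul] at h
      exact_mod_cast h
    refine ⟨c, m.toNat, Subtype.ext (Eq.trans ?_ (hcoe _ _).symm)⟩
    change (s : ℚ) = m.toNat * g c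
    have hcast : ((m.toNat : ℕ) : ℚ) = m := by exact_mod_cast Int.toNat_of_nonneg hm0
    rw [hcast, hgc, hm]
    ring

end Scale

/-! ### The dense cocone on `C*_r(S)` -/

theorem shift_nsmul {S : Type u} [AddLeftCancelMonoid S] (k : ℕ) (g : S) :
    shift (k • g) = shift g ^ k := by
  induction k with
  | zero =>
    refine clm_ext_basisVec fun s => ?_
    rw [zero_nsmul, pow_zero, shift_basisVec, zero_add]
    rfl
  | succ k ih =>
    rw [pow_succ, ← ih]
    refine clm_ext_basisVec fun s => ?_
    rw [succ_nsmul, shift_basisVec, mul_apply_eq_comp, shift_basisVec, shift_basisVec, add_assoc]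

/-- Embeddings `T ↦ V_{g_a}` form a dense cocone as soon as every element of the semigroup is a
multiple of some `g_a`. -/
theorem isDenseCocone_of_generators {K : Type u} [PartialOrder K] [IsDirectedOrder K] [Nonempty K]
    {n : K → K → ℕ+} (hn : ∀ a b c : K, a ≤ b → b ≤ c → n c a = n c b * n b a)
    {S : Type v} [AddLeftCancelMonoid S] {g : K → S}
    (hg : ∀ a b, a ≤ b → g a = (n b a : ℕ) • g b) (hgen : ∀ s : S, ∃ (c : K) (k : ℕ), s = k • g c)
    {σ : K → (Toeplitz →⋆ₐ[ℂ] ReducedCStar S)}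
    (hσ : ∀ a, σ a toeplitzT = ⟨shift (g a), shift_mem (g a)⟩)
    (hinj : ∀ a, Function.Injective (σ a)) :
    IsDenseCocone (toeplitzSystem n hn) (ReducedCStar S) σ := by
  have hcomp : ∀ {a b : K}, a ≤ b → σ a = (σ b).comp (toeplitzEnd (n b a)) := by
    intro a b hab
    refine toeplitz_hom_ext ?_
    rw [StarAlgHom.comp_apply, toeplitzEnd_T, map_pow, hσ, hσ]
    refine Subtype.ext ?_
    change shift (g a) = shift (g b) ^ (n b a : ℕ)
    rw [hg a b hab, shift_nsmul]
  refine ⟨hinj, fun hab => hcomp hab, ?_⟩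
  -- The union of the images is a star subalgebra, because the system is directed, and it contains
  -- every `V_s = V_{g_c} ^ k`.
  let ι : ReducedCStar S →⋆ₐ[ℂ] (Ell2 S →L[ℂ] Ell2 S) := (ReducedCStar S).subtype
  let R : K → StarSubalgebra ℂ (Ell2 S →L[ℂ] Ell2 S) := fun a => (ι.comp (σ a)).range
  have hdir : Directed (· ≤ ·) R := by
    have hmono : Monotone R := by
      rintro a b hab _ ⟨t, rfl⟩
      refine ⟨toeplitzEnd (n b a) t, ?_⟩
      rw [hcomp hab]
      rfl
    exact hmono.directed_le
  have hle : StarAlgebra.adjoin ℂ (Set.range (shift : S → Ell2 S →L[ℂ] Ell2 S)) ≤ iSup R := by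
    refine StarAlgebra.adjoin_le ?_
    rintro _ ⟨s, rfl⟩
    obtain ⟨c, k, rfl⟩ := hgen s
    refine (le_iSup R c : R c ≤ iSup R) ⟨toeplitzT ^ k, ?_⟩
    change ((σ c (toeplitzT ^ k) : ReducedCStar S) : Ell2 S →L[ℂ] Ell2 S) = shift (k • g c)
    rw [map_pow, hσ, shift_nsmul]
    rfl
  have himage : (Subtype.val '' ⋃ a, Set.range (σ a)) =
      ((iSup R : StarSubalgebra ℂ (Ell2 S →L[ℂ] Ell2 S)) : Set (Ell2 S →L[ℂ] Ell2 S)) := by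
    rw [StarSubalgebra.coe_iSup_of_directed hdir, Set.image_iUnion]
    refine Set.iUnion_congr fun a => ?_
    rw [← Set.range_comp]
    rfl
  refine Set.eq_univ_of_forall fun y => ?_
  have hy := closure_mono hle y.2
  rw [← himage] at hy
  exact closure_subtype.2 hy

end ToeplitzLimit

end

open ToeplitzLimit
theorem theorem4p1 {K : Type u} [PartialOrder K] [IsDirectedOrder K] [Nonempty K]
    (n : K → K → ℕ+) (hn : ∀ a b c : K, a ≤ b → b ≤ c → n c a = n c b * n b a) :
    ∃ M : ℕ → ℕ+,
      (∃ σ : ∀ a, (toeplitzSystem n hn).obj a →⋆ₐ[ℂ] ReducedCStar (posCone (ratGroup M)),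
        IsInductiveLimit.{u, 0, 0, x} (toeplitzSystem n hn)
          (ReducedCStar (posCone (ratGroup M))) σ) ∧
      ∀ (A : Type w) [CStarAlgebra A] (σ : ∀ a, (toeplitzSystem n hn).obj a →⋆ₐ[ℂ] A),
        IsInductiveLimit.{u, 0, w, x} (toeplitzSystem n hn) A σ →
          Nonempty (ReducedCStar (posCone (ratGroup M)) ≃⋆ₐ[ℂ] A) := by
  obtain ⟨M, g, hpos, hg, hgen⟩ := exists_ratGroup_generators hn
  choose σ hσ hinj using fun a => exists_posCone_embedding (g a) (hpos a)
  have hcocone : IsDenseCocone (toeplitzSystem n hn) (ReducedCStar (posCone (ratGroup M))) σ :=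
    isDenseCocone_of_generators hn hg hgen hσ hinj
  refine ⟨M, ⟨σ, hcocone, fun B _ ψ hψ => hcocone.existsUnique_iso hψ⟩, fun A _ τ hτ => ?_⟩
  obtain ⟨θ, -, -⟩ := hcocone.existsUnique_iso hτ.toIsDenseCocone
  exact ⟨θ⟩
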